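/- Let $q$ be a complex number with $0<|q|<1$. Write $(a;q)_n=\prod_{i=0}^{n-1}(1-aq^i)$, $(q)_n=(q;q)_n$, $(a;q)_\infty=\prod_{i\ge 0}(1-aq^i)$ and $(a,b,c;q)_\infty=(a;q)_\infty(b;q)_\infty(c;q)_\infty$. Let $k,r,j\ge 0$ be integers with $j+r\le k$. Then $$ \sum_{s_1\ge s_2\ge\cdots\ge s_k\ge 0} \frac{q^{-s_1-\cdots-s_j}\,(1+q^{s_1+s_2})(1+q^{s_2+s_3})\cdots(1+q^{s_{j-1}+s_j})}{(q)_{s_1-s_2}\cdots(q)_{s_{k-1}-s_k}(q)_{s_k}}\; q^{s_1^2+\cdots+s_k^2+s_{k-r+1}+\cdots+s_k} =\sum_{s=0}^{j}\binom{j}{s}\frac{(q^{k+1-r+j-2s},\,q^{k+2+r-j+2s},\,q^{2k+3};\,q^{2k+3})_\infty}{(q;q)_\infty}, $$ where the sum on the left is over integers $s_1,\dots,s_k$ and converges absolutely. Moreover, put $f_1=q^{-s_1}$ and $f_i=q^{-s_i}(1+q^{s_{i-1}+s_i})$ for $i\ge 2$, so that the numerator of the fraction on the left is $f_1f_2\cdots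 f_j$. The identity remains true, with the same right side and again with absolute convergence, when $f_1f_2\cdots f_j$ is replaced by $\prod_{i\in S}f_i$ for any $j$-element subset $S$ of $\{1,2,\dots,k-r\}$. -/

import Mathlib

noncomputable section

namespace BinomialAndrewsGordon

/-- The finite `q`-shifted factorial `(a; q)_n = ∏_{i=0}^{n-1} (1 - a q^i)`. -/
def qPoch (a q : ℂ) (n : ℕ) : ℂ := ∏ i ∈ Finset.range n, (1 - a * q ^ i)

/-- The infinite `q`-shifted factorial `(a; q)_∞ = ∏_{i ≥ 0} (1 - a q^i)`. -/
def qPochInf (a q : ℂ) : ℂ := ∏' i : ℕ, (1 - a * q ^ i)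

/-- For `‖q‖ < 1` the infinite product defining `(a; q)_∞` converges,
so `qPochInf` is never a default value there. -/
theorem hasProd_qPochInf (a q : ℂ) (hq : ‖q‖ < 1) :
    HasProd (fun i : ℕ => 1 - a * q ^ i) (qPochInf a q) := by
  have h : Multipliable (fun i : ℕ => 1 + -(a * q ^ i)) := by
    apply multipliable_one_add_of_summable
    simp only [norm_neg, norm_mul, norm_pow]
    exact (summable_geometric_of_lt_one (norm_nonneg q) hq).mul_left _
  simp only [← sub_eq_add_neg] at h
  exact h.hasProd

/-- The summation range: sequences `s_1 ≥ s_2 ≥ ⋯ ≥ s_k ≥ 0` of integers. -/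
abbrev Chain (k : ℕ) : Type := {s : Fin k → ℕ // Antitone s}

/-- The entry `s_i`, with the index `i` running from `1` to `k`; in addition `s_i = 0` for `i`
outside this range, so that `s_k - s_{k+1} = s_k`. -/
def Chain.part {k : ℕ} (s : Chain k) (i : ℕ) : ℕ :=
  if h : 1 ≤ i ∧ i ≤ k then s.1 ⟨i - 1, by omega⟩ else 0

/-- The Andrews–Gordon summand
`q^{s_1^2 + ⋯ + s_k^2 + s_{k-r+1} + ⋯ + s_k} /
  ((q)_{s_1-s_2} ⋯ (q)_{s_{k-1}-s_k} (q)_{s_k})`, where `(q)_n = (q; q)_n`. -/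
def agTerm (q : ℂ) (k r : ℕ) (s : Chain k) : ℂ :=
  q ^ (∑ i ∈ Finset.Icc 1 k, s.part i ^ 2 + ∑ i ∈ Finset.Icc (k - r + 1) k, s.part i) /
    ∏ i ∈ Finset.Icc 1 k, qPoch q q (s.part i - s.part (i + 1))

/-- The factor attached to the index `i ≥ 1`: it is `q^{-s_1}` for `i = 1` and
`q^{-s_i} (1 + q^{s_{i-1} + s_i})` for `i ≥ 2`. -/
def binomFactor (q : ℂ) {k : ℕ} (s : Chain k) (i : ℕ) : ℂ :=
  if i = 1 then q ^ (-(s.part 1 : ℤ))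
  else q ^ (-(s.part i : ℤ)) * (1 + q ^ (s.part (i - 1) + s.part i))

/-- The product side
`∑_{s=0}^{j} C(j,s) (q^{k+1-r+j-2s}, q^{k+2+r-j+2s}, q^{2k+3}; q^{2k+3})_∞ / (q; q)_∞`. -/
def productSide (q : ℂ) (k r j : ℕ) : ℂ :=
  ∑ s ∈ Finset.range (j + 1), (j.choose s : ℂ) *
    (qPochInf (q ^ ((k : ℤ) + 1 - r + j - 2 * s)) (q ^ (2 * k + 3)) *
      qPochInf (q ^ ((k : ℤ) + 2 + r - j + 2 * s)) (q ^ (2 * k + 3)) *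
      qPochInf (q ^ (2 * k + 3)) (q ^ (2 * k + 3)) / qPochInf q q)

end BinomialAndrewsGordon

end

noncomputable section

namespace BinomialAndrewsGordon

open Finset Filter Topology

/-! The proof iterates a bilateral Bailey lemma and then lets the outer parameter `L` tend to
infinity. Pairs satisfy `β_n = ∑_p α_p / ((q)_{n-p} (q)_{n+p+c})` with `c = 0` or `1`. Summing `β`
against `q^{n^2+cn} / (q)_{L-n}` multiplies `α` by `q^{p^2+cp}` (`sum_kernel`). For `c = 0`,
inserting `q^{-n}(1+q^{L+n})` in the sum brings in a further factor `q^p + q^{-p}`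
(`sum_kernel_binom`).

The start is the unit pair `α_p = (-1)^p q^{p(p-1)/2}`, `β_n = δ_{n,0}`. The reflection `p ↦ -1-p`
makes it a pair for both values of `c`, and this survives the `c = 1` steps. So the `q^{n^2+n}`
steps (the inner variables) are done at `c = 1`, and the remaining `k-r` steps at `c = 0`. Each
index in `S` contributes the same factor to `α`, so only the cardinality of `S` matters.

As `L → ∞`, both expressions for `β_L` converge by dominated convergence. Expanding `(q^p +
q^{-p})^j` leaves theta series in base `q^{2k+3}`, which the Jacobi triple product evaluates.
Unconditional summability in `ℂ`, as expressed by `HasSum`, is absolute convergence. -/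

/-! ### Reciprocals of `(q; q)_m` and the Bailey kernels -/

/-- `1 / (q; q)_m`, extended by zero to negative `m`. -/
def invPoch (q : ℂ) (m : ℤ) : ℂ := if 0 ≤ m then (qPoch q q m.toNat)⁻¹ else 0

/-- The Bailey kernel `1 / ((q; q)_{n-p} (q; q)_{n+p+c})`. -/
def kernel (q : ℂ) (c n p : ℤ) : ℂ := invPoch q (n - p) * invPoch q (n + p + c)

theorem qPoch_zero (a q : ℂ) : qPoch a q 0 = 1 := by simp [qPoch]

theorem qPoch_succ (a q : ℂ) (n : ℕ) : qPoch a q (n + 1) = qPoch a q n * (1 - a * q ^ n) := by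
  simp [qPoch, prod_range_succ]

theorem one_sub_pow_succ_ne_zero {q : ℂ} (hq1 : ‖q‖ < 1) (n : ℕ) : 1 - q ^ (n + 1) ≠ 0 := by
  intro h
  have h1 : ‖q ^ (n + 1)‖ < 1 := by
    rw [norm_pow]
    exact pow_lt_one₀ (norm_nonneg q) hq1 (by omega)
  rw [← sub_eq_zero.1 h] at h1
  simp at h1

theorem qPoch_self_ne_zero {q : ℂ} (hq1 : ‖q‖ < 1) (n : ℕ) : qPoch q q n ≠ 0 := by
  refine prod_ne_zero_iff.2 fun i _ => ?_
  rw [← pow_succ']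
  exact one_sub_pow_succ_ne_zero hq1 i

theorem invPoch_natCast (q : ℂ) (n : ℕ) : invPoch q n = (qPoch q q n)⁻¹ := by
  simp [invPoch]

theorem invPoch_of_neg (q : ℂ) {m : ℤ} (hm : m < 0) : invPoch q m = 0 := by
  simp [invPoch, hm]

theorem invPoch_zero (q : ℂ) : invPoch q 0 = 1 := by
  simp [invPoch, qPoch_zero]

theorem invPoch_sub_one {q : ℂ} (hq1 : ‖q‖ < 1) (m : ℤ) :
    invPoch q (m - 1) = (1 - q ^ m) * invPoch q m := by
  rcases lt_trichotomy m 0 with hm | rfl | hm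
  · rw [invPoch_of_neg q hm, invPoch_of_neg q (by omega), mul_zero]
  · rw [invPoch_of_neg q (by omega)]
    simp
  · obtain ⟨n, rfl⟩ : ∃ n : ℕ, m = (n + 1 : ℕ) := ⟨(m - 1).toNat, by omega⟩
    have h1 := one_sub_pow_succ_ne_zero hq1 n
    have h2 := qPoch_self_ne_zero hq1 n
    have h3 : ((n + 1 : ℕ) : ℤ) - 1 = (n : ℕ) := by push_cast; ring
    rw [h3, invPoch_natCast, invPoch_natCast, qPoch_succ, zpow_natCast, ← pow_succ']
    field_simp

theorem kernel_symm (q : ℂ) (c n p : ℤ) : kernel q c n (-p - c) = kernel q c n p := by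
  rw [kernel, kernel, mul_comm]
  congr 2 <;> ring

theorem kernel_eq_zero_of_lt (q : ℂ) {c n p : ℤ} (h : n < p) : kernel q c n p = 0 := by
  rw [kernel, invPoch_of_neg q (by omega), zero_mul]

theorem kernel_eq_zero_of_add_neg (q : ℂ) {c n p : ℤ} (h : n + p + c < 0) :
    kernel q c n p = 0 := by
  rw [kernel, invPoch_of_neg q h, mul_zero]

/-- A limiting case of the `q`-Vandermonde summation. -/
theorem sum_durfee {q : ℂ} (hq0 : q ≠ 0) (hq1 : ‖q‖ < 1) (N a : ℕ) :
    ∑ m ∈ range (N + 1), q ^ (m * (m + a)) *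
      (invPoch q (N - m) * invPoch q m * invPoch q (m + a)) =
    invPoch q N * invPoch q (N + a) := by
  induction N generalizing a with
  | zero => simp [invPoch_zero]
  | succ N ih =>
    have hne := one_sub_pow_succ_ne_zero hq1 N
    apply mul_left_cancel₀ hne
    have hN : invPoch q N = (1 - q ^ (N + 1)) * invPoch q (N + 1 : ℕ) := by
      have := invPoch_sub_one hq1 (N + 1 : ℕ)
      rw [zpow_natCast] at this
      rw [← this]
      congr 1
      push_cast
      ring
    -- Split `1 - q^{N+1} = q^m (1 - q^{N+1-m}) + (1 - q^m)`. After `m ↦ m+1` in the second part,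
    -- the two parts recombine into the sum for `(N, a+1)`.
    have hterm : ∀ m : ℕ, (1 - q ^ (N + 1)) * (q ^ (m * (m + a)) *
        (invPoch q ((N + 1 : ℕ) - m) * invPoch q m * invPoch q (m + a))) =
        q ^ (m * (m + (a + 1))) * (1 - q ^ (m + (a + 1))) *
          (invPoch q (N - m) * invPoch q m * invPoch q (m + (a + 1 : ℕ))) +
        q ^ (m * (m + a)) *
          (invPoch q ((N + 1 : ℕ) - m) * invPoch q (m - 1) * invPoch q (m + a)) := by
      intro m
      have h1 := invPoch_sub_one hq1 ((N + 1 : ℕ) - m)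
      have h2 := invPoch_sub_one hq1 m
      have h3 := invPoch_sub_one hq1 (m + (a + 1 : ℕ))
      have e1 : ((N + 1 : ℕ) : ℤ) - m - 1 = N - m := by push_cast; ring
      have e3 : (m : ℤ) + (a + 1 : ℕ) - 1 = m + a := by push_cast; ring
      have e4 : (m : ℤ) + (a + 1 : ℕ) = (m + (a + 1) : ℕ) := by push_cast; ring
      rw [e1, zpow_sub₀ hq0, zpow_natCast, zpow_natCast] at h1
      rw [zpow_natCast] at h2
      rw [e3, e4, zpow_natCast] at h3
      rw [h1, h2, e4, h3]
      have hqm : q ^ m ≠ 0 := pow_ne_zero _ hq0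
      field_simp
      ring
    rw [mul_sum, sum_congr rfl fun m _ => hterm m, sum_add_distrib, sum_range_succ,
      sum_range_succ' (fun m : ℕ => q ^ (m * (m + a)) *
          (invPoch q ((N + 1 : ℕ) - m) * invPoch q (m - 1) * invPoch q (m + a)))]
    rw [invPoch_of_neg q (show (N : ℤ) - (N + 1 : ℕ) < 0 by push_cast; omega),
      invPoch_of_neg q (show ((0 : ℕ) : ℤ) - 1 < 0 by norm_num)]
    simp only [zero_mul, mul_zero, add_zero]
    rw [← sum_add_distrib, ← mul_assoc, ← hN]
    have := ih (a + 1)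
    have e5 : (N : ℤ) + (a + 1 : ℕ) = (N + 1 : ℕ) + a := by push_cast; ring
    rw [e5] at this
    rw [← this]
    refine sum_congr rfl fun m _ => ?_
    have e6 : ((N + 1 : ℕ) : ℤ) - (m + 1 : ℕ) = N - m := by push_cast; ring
    have e7 : ((m + 1 : ℕ) : ℤ) - 1 = m := by push_cast; ring
    have e8 : ((m + 1 : ℕ) : ℤ) + a = m + (a + 1 : ℕ) := by push_cast; ring
    rw [e6, e7, e8]
    ring

/-- Only `p ≤ n ≤ L` contributes, and `n = p + m` turns the sum into `sum_durfee` with `a = 2p + c`.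
The slack between `L` and `B` lets `sum_kernel_binom` use the values `L` and `L - 1` over one range.
-/
theorem sum_kernel_of_nonneg {q : ℂ} (hq0 : q ≠ 0) (hq1 : ‖q‖ < 1) (c p B : ℕ) {L : ℤ}
    (hL : L ≤ B) :
    ∑ n ∈ range (B + 1), q ^ ((n : ℤ) ^ 2 + c * n) * invPoch q (L - n) * kernel q c n p =
      q ^ ((p : ℤ) ^ 2 + c * p) * kernel q c L p := by
  rcases lt_or_ge L p with h | h
  · rw [kernel_eq_zero_of_lt q h, mul_zero]
    refine sum_eq_zero fun n _ => ?_
    rcases lt_or_ge L n with h' | h'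
    · rw [invPoch_of_neg q (by omega)]
      ring
    · rw [kernel_eq_zero_of_lt q (by omega), mul_zero]
  · obtain ⟨N, rfl⟩ : ∃ N : ℕ, L = p + N := ⟨(L - p).toNat, by omega⟩
    obtain ⟨D, rfl⟩ : ∃ D : ℕ, B = p + N + D := ⟨B - p - N, by omega⟩
    have key := sum_durfee hq0 hq1 N (2 * p + c)
    rw [show p + N + D + 1 = p + (N + 1) + D by ring, sum_range_add, sum_range_add,
      sum_eq_zero (s := range p), sum_eq_zero (s := range D), zero_add, add_zero]
    · have e1 : ((p : ℤ) + N) - p = N := by ring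
      have e2 : ((p : ℤ) + N) + p + c = N + (2 * p + c : ℕ) := by push_cast; ring
      rw [kernel, e1, e2, ← key, mul_sum]
      refine sum_congr rfl fun m _ => ?_
      have e3 : ((p : ℤ) + N) - (p + m : ℕ) = N - m := by push_cast; ring
      have e4 : ((p + m : ℕ) : ℤ) - p = m := by push_cast; ring
      have e5 : ((p + m : ℕ) : ℤ) + p + c = m + (2 * p + c : ℕ) := by push_cast; ring
      have e6 : (((p + m : ℕ) : ℤ) ^ 2 + c * (p + m : ℕ)) =
        ((p : ℤ) ^ 2 + c * p) + (m * (m + (2 * p + c)) : ℕ) := by push_cast; ring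
      rw [kernel, e3, e4, e5, e6, zpow_add₀ hq0, zpow_natCast]
      ring
    · intro n _
      rw [invPoch_of_neg q (by push_cast; omega)]
      ring
    · intro n hn
      rw [kernel_eq_zero_of_lt q (by have := mem_range.1 hn; omega), mul_zero]

/-- The Bailey lemma for the bilateral kernels. -/
theorem sum_kernel {q : ℂ} (hq0 : q ≠ 0) (hq1 : ‖q‖ < 1) {c : ℕ} (hc : c ≤ 1) (p : ℤ) (B : ℕ)
    {L : ℤ} (hL : L ≤ B) :
    ∑ n ∈ range (B + 1), q ^ ((n : ℤ) ^ 2 + c * n) * invPoch q (L - n) * kernel q c n p =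
      q ^ (p ^ 2 + c * p) * kernel q c L p := by
  rcases le_or_gt 0 p with hp | hp
  · obtain ⟨p, rfl⟩ := Int.eq_ofNat_of_zero_le hp
    exact sum_kernel_of_nonneg hq0 hq1 c p B hL
  -- The kernel is invariant under `p ↦ -p-c`. This sends negative `p` to a nonnegative index
  -- precisely because `c ≤ 1`.
  · obtain ⟨t, ht⟩ := Int.eq_ofNat_of_zero_le (show 0 ≤ -p - c by omega)
    have key := sum_kernel_of_nonneg hq0 hq1 c t B hL
    rw [← ht] at key
    simp only [kernel_symm] at key
    rw [key]
    congr 2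
    ring

/-- The Bailey lattice step that multiplies the `α` side by `q ^ p + q ^ (-p)`. -/
theorem sum_kernel_binom {q : ℂ} (hq0 : q ≠ 0) (hq1 : ‖q‖ < 1) (p : ℤ) (B : ℕ)
    {L : ℤ} (hL : L ≤ B) :
    ∑ n ∈ range (B + 1), q ^ ((n : ℤ) ^ 2) * (q ^ (-(n : ℤ)) * (1 + q ^ (L + n))) *
        invPoch q (L - n) * kernel q 0 n p =
      q ^ (p ^ 2) * (q ^ p + q ^ (-p)) * kernel q 0 L p := by
  have hA := sum_kernel hq0 hq1 (c := 0) (by norm_num) p B hL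
  have hV := sum_kernel hq0 hq1 (c := 1) le_rfl p B (L := L - 1) (by omega)
  simp only [Nat.cast_zero, zero_mul, add_zero, Nat.cast_one, one_mul] at hA hV
  -- The factor `1 - q^{n-p}` turns the `c = 0` kernel at `n` into the `c = 1` kernel at `n - 1`, so
  -- this is the `c = 1` Bailey lemma at `L - 1`. The term `n = 0` vanishes for every `p`.
  have hshift : ∑ n ∈ range (B + 1), q ^ ((n : ℤ) ^ 2 - n) * invPoch q (L - n) *
      ((1 - q ^ ((n : ℤ) - p)) * kernel q 0 n p) = q ^ (p ^ 2 + p) * kernel q 1 (L - 1) p := by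
    rw [← hV, sum_range_succ', sum_range_succ (n := B)]
    have h0 : (1 - q ^ (((0 : ℕ) : ℤ) - p)) * kernel q 0 (0 : ℕ) p = 0 := by
      rcases lt_trichotomy p 0 with h | rfl | h
      · rw [kernel_eq_zero_of_add_neg q (by push_cast; omega), mul_zero]
      · simp
      · rw [kernel_eq_zero_of_lt q (by push_cast; omega), mul_zero]
    rw [h0, invPoch_of_neg q (show L - 1 - (B : ℤ) < 0 by omega)]
    simp only [mul_zero, zero_mul, add_zero]
    refine sum_congr rfl fun n _ => ?_
    rw [kernel, kernel, ← mul_assoc (1 - _), ← invPoch_sub_one hq1]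
    have e1 : ((n + 1 : ℕ) : ℤ) ^ 2 - (n + 1 : ℕ) = (n : ℤ) ^ 2 + n := by push_cast; ring
    have e2 : L - ((n + 1 : ℕ) : ℤ) = L - 1 - n := by push_cast; ring
    have e3 : ((n + 1 : ℕ) : ℤ) - p - 1 = n - p := by push_cast; ring
    have e4 : ((n + 1 : ℕ) : ℤ) + p + 0 = n + p + 1 := by push_cast; ring
    rw [e1, e2, e3, e4]
  -- Adding and subtracting `q^{n^2-p}` writes the weight as a multiple of `q^{n^2}` constant in
  -- `n`, plus the part treated in `hshift`.
  have hterm : ∀ n : ℕ, q ^ ((n : ℤ) ^ 2) * (q ^ (-(n : ℤ)) * (1 + q ^ (L + n))) *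
        invPoch q (L - n) * kernel q 0 n p =
      (q ^ (-p) + q ^ L) * (q ^ ((n : ℤ) ^ 2) * invPoch q (L - n) * kernel q 0 n p) +
      q ^ ((n : ℤ) ^ 2 - n) * invPoch q (L - n) *
        ((1 - q ^ ((n : ℤ) - p)) * kernel q 0 n p) := by
    intro n
    have h1 : q ^ n ≠ 0 := pow_ne_zero _ hq0
    have h2 : q ^ p ≠ 0 := zpow_ne_zero _ hq0
    simp only [zpow_sub₀ hq0, zpow_add₀ hq0, zpow_neg, zpow_natCast]
    field_simp
    ring
  rw [sum_congr rfl fun n _ => hterm n, sum_add_distrib, ← mul_sum, hA, hshift]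
  have hk : kernel q 1 (L - 1) p = (1 - q ^ (L - p)) * kernel q 0 L p := by
    rw [kernel, kernel, ← mul_assoc, ← invPoch_sub_one hq1]
    congr 2 <;> ring
  rw [hk]
  have h2 : q ^ p ≠ 0 := zpow_ne_zero _ hq0
  simp only [zpow_sub₀ hq0, zpow_add₀ hq0, zpow_neg]
  field_simp
  ring

/-! ### The Jacobi triple product -/

/-- The integer `p (p - 1) / 2`. -/
def tri (p : ℤ) : ℤ := p * (p - 1) / 2

theorem two_mul_tri (p : ℤ) : 2 * tri p = p * (p - 1) := by
  have h : (2 : ℤ) ∣ p * (p - 1) := by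
    have := Int.even_mul_pred_self p
    exact this.two_dvd
  exact Int.mul_ediv_cancel' h

theorem tri_add_one (p : ℤ) : tri (p + 1) = tri p + p := by
  have h1 := two_mul_tri p
  have h2 := two_mul_tri (p + 1)
  exact mul_left_cancel₀ (two_ne_zero (α := ℤ)) (by linear_combination h2 - h1)

theorem tri_zero : tri 0 = 0 := by simp [tri]

/-- The finite `q`-binomial theorem. -/
theorem sum_q_binomial {q : ℂ} (hq0 : q ≠ 0) (hq1 : ‖q‖ < 1) (w : ℂ) (N : ℕ) :
    ∑ i ∈ range (N + 1), (-w) ^ i * q ^ tri i * (invPoch q i * invPoch q (N - i)) =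
      qPoch w q N * invPoch q N := by
  induction N with
  | zero => simp [invPoch_zero, qPoch_zero, tri_zero]
  | succ N ih =>
    have hne := one_sub_pow_succ_ne_zero hq1 N
    apply mul_left_cancel₀ hne
    have hN : invPoch q N = (1 - q ^ (N + 1)) * invPoch q (N + 1 : ℕ) := by
      have := invPoch_sub_one hq1 (N + 1 : ℕ)
      rw [zpow_natCast] at this
      rw [← this]
      congr 1
      push_cast
      ring
    -- Split `1 - q^{N+1} = (1 - q^{N+1-i}) + q^{N+1-i} (1 - q^i)`, the `q`-Pascal recurrence.
    have hterm : ∀ i : ℕ, (1 - q ^ (N + 1)) * ((-w) ^ i * q ^ tri i *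
        (invPoch q i * invPoch q ((N + 1 : ℕ) - i))) =
        (-w) ^ i * q ^ tri i * (invPoch q i * invPoch q (N - i)) +
        (-w) ^ i * q ^ tri i * q ^ ((N + 1 : ℕ) - i : ℤ) *
          (invPoch q (i - 1) * invPoch q ((N + 1 : ℕ) - i)) := by
      intro i
      have h1 := invPoch_sub_one hq1 ((N + 1 : ℕ) - i)
      have h2 := invPoch_sub_one hq1 i
      have e1 : ((N + 1 : ℕ) : ℤ) - i - 1 = N - i := by push_cast; ring
      rw [e1] at h1
      rw [h1, h2, zpow_sub₀ hq0, zpow_natCast, zpow_natCast]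
      have hqi : q ^ i ≠ 0 := pow_ne_zero _ hq0
      field_simp
      ring
    rw [mul_sum, sum_congr rfl fun i _ => hterm i, sum_add_distrib, sum_range_succ,
      sum_range_succ' (fun i : ℕ => (-w) ^ i * q ^ tri i * q ^ ((N + 1 : ℕ) - i : ℤ) *
          (invPoch q (i - 1) * invPoch q ((N + 1 : ℕ) - i))), ih]
    rw [invPoch_of_neg q (show (N : ℤ) - (N + 1 : ℕ) < 0 by push_cast; omega),
      invPoch_of_neg q (show ((0 : ℕ) : ℤ) - 1 < 0 by norm_num)]
    simp only [zero_mul, mul_zero, add_zero]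
    have hsecond : ∑ i ∈ range (N + 1), (-w) ^ (i + 1) * q ^ tri (i + 1 : ℕ) *
        q ^ ((N + 1 : ℕ) - (i + 1 : ℕ) : ℤ) *
          (invPoch q ((i + 1 : ℕ) - 1) * invPoch q ((N + 1 : ℕ) - (i + 1 : ℕ))) =
        -w * q ^ N * (qPoch w q N * invPoch q N) := by
      rw [← ih, mul_sum]
      refine sum_congr rfl fun i _ => ?_
      have e6 : ((N + 1 : ℕ) : ℤ) - (i + 1 : ℕ) = N - i := by push_cast; ring
      have e7 : ((i + 1 : ℕ) : ℤ) - 1 = i := by push_cast; ring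
      have e8 : ((i + 1 : ℕ) : ℤ) = i + 1 := by push_cast; ring
      have hqi : q ^ i ≠ 0 := pow_ne_zero _ hq0
      rw [e6, e7, e8, tri_add_one, zpow_add₀ hq0, zpow_sub₀ hq0, zpow_natCast, zpow_natCast]
      field_simp
      ring
    rw [hsecond, qPoch_succ, hN]
    ring

theorem qPoch_add (a q : ℂ) (m n : ℕ) :
    qPoch a q (m + n) = qPoch a q m * qPoch (a * q ^ m) q n := by
  simp only [qPoch, prod_range_add]
  congr 1
  refine prod_congr rfl fun i _ => ?_
  rw [pow_add]
  ring

theorem qPoch_reverse {q z : ℂ} (hq0 : q ≠ 0) (hz : z ≠ 0) (n : ℕ) :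
    qPoch (z * q ^ (-(n : ℤ))) q n = (-z) ^ n * q ^ (-tri (n + 1)) * qPoch (q / z) q n := by
  induction n with
  | zero => simp [qPoch_zero, tri]
  | succ n ih =>
    have h1 := qPoch_add (z * q ^ (-((n + 1 : ℕ) : ℤ))) q 1 n
    have e1 : z * q ^ (-((n + 1 : ℕ) : ℤ)) * q ^ 1 = z * q ^ (-(n : ℤ)) := by
      rw [mul_assoc, pow_one, ← zpow_add_one₀ hq0]
      congr 2
      push_cast
      ring
    rw [e1, ih, add_comm 1 n] at h1
    rw [h1, qPoch_succ, qPoch_zero, qPoch_succ]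
    have e2 : tri (((n + 1 : ℕ) : ℤ) + 1) = tri (n + 1) + (n + 1 : ℕ) := by
      rw [tri_add_one]
      push_cast
      rfl
    have hqn : q ^ n ≠ 0 := pow_ne_zero _ hq0
    rw [e2, neg_add, zpow_add₀ hq0]
    simp only [zpow_neg, zpow_natCast]
    field_simp
    ring

/-- The finite form of the Jacobi triple product. -/
theorem hasSum_finite_jacobi {q z : ℂ} (hq0 : q ≠ 0) (hq1 : ‖q‖ < 1) (hz : z ≠ 0) (n : ℕ) :
    HasSum (fun p : ℤ => (-z) ^ p * q ^ tri p * kernel q 0 n p)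
      (qPoch z q n * qPoch (q / z) q n * invPoch q (2 * n : ℕ)) := by
  have hinj : Function.Injective (fun i : ℕ => (i : ℤ) - n) := by
    intro a b h
    simpa using h
  rw [← hinj.hasSum_iff]
  · have hz' : -z ≠ 0 := neg_ne_zero.2 hz
    -- Length `2n` and argument `z q^{-n}` centre the binomial sum: with `p = i - n` it runs over
    -- `-n ≤ p ≤ n`, and the lower half of the product reverses into `(q/z; q)_n`.
    have key := sum_q_binomial hq0 hq1 (z * q ^ (-(n : ℤ))) (2 * n)
    have hconst : (-z) ^ n * q ^ (-tri (n + 1)) ≠ 0 :=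
      mul_ne_zero (pow_ne_zero _ hz') (zpow_ne_zero _ hq0)
    have hprod : qPoch (z * q ^ (-(n : ℤ))) q (2 * n) =
        (-z) ^ n * q ^ (-tri (n + 1)) * (qPoch z q n * qPoch (q / z) q n) := by
      rw [two_mul, qPoch_add, qPoch_reverse hq0 hz]
      have : z * q ^ (-(n : ℤ)) * q ^ n = z := by
        have hqn : q ^ n ≠ 0 := pow_ne_zero _ hq0
        rw [zpow_neg, zpow_natCast]
        field_simp
      rw [this]
      ring
    rw [hprod] at key
    have hval : qPoch z q n * qPoch (q / z) q n * invPoch q (2 * n : ℕ) =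
        ∑ i ∈ range (2 * n + 1), (-z) ^ ((i : ℤ) - n) * q ^ tri ((i : ℤ) - n) *
          kernel q 0 n ((i : ℤ) - n) := by
      apply mul_left_cancel₀ hconst
      rw [← mul_assoc, ← key, mul_sum]
      refine sum_congr rfl fun i _ => ?_
      have e1 : (n : ℤ) - ((i : ℤ) - n) = (2 * n : ℕ) - i := by push_cast; ring
      have e2 : (n : ℤ) + ((i : ℤ) - n) + 0 = i := by ring
      have e3 : tri ((i : ℤ) - n) + -tri (n + 1) = tri i + -n * i := by
        have h1 := two_mul_tri ((i : ℤ) - n)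
        have h2 := two_mul_tri ((n : ℤ) + 1)
        have h3 := two_mul_tri (i : ℤ)
        exact mul_left_cancel₀ (two_ne_zero (α := ℤ)) (by linear_combination h1 - h2 - h3)
      have e4 : (-(z * q ^ (-(n : ℤ)))) ^ i = (-z) ^ i * q ^ (-(n : ℤ) * i) := by
        rw [zpow_mul, zpow_natCast, ← mul_pow]
        ring
      have e5 : (-z) ^ ((i : ℤ) - n) * (-z) ^ n = (-z) ^ i := by
        rw [← zpow_natCast, ← zpow_natCast, ← zpow_add₀ hz']
        congr 1
        ring
      rw [kernel, e1, e2, e4, ← e5]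
      have e6 : q ^ tri ((i : ℤ) - n) * q ^ (-tri (n + 1)) = q ^ tri i * q ^ (-(n : ℤ) * i) := by
        rw [← zpow_add₀ hq0, e3, zpow_add₀ hq0]
      linear_combination (-1) * (-z) ^ ((i : ℤ) - n) * (-z) ^ n * invPoch q i *
        invPoch q ((2 * n : ℕ) - i) * e6
    rw [hval]
    apply hasSum_sum_of_ne_finset_zero
    intro i hi
    have : 2 * n + 1 ≤ i := by simpa using hi
    simp only [Function.comp]
    rw [kernel_eq_zero_of_lt q (by omega), mul_zero]
  · intro p hp
    have : p < -n := by
      by_contra h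
      exact hp ⟨(p + n).toNat, by simp only; omega⟩
    rw [kernel_eq_zero_of_add_neg q (by omega), mul_zero]

theorem tendsto_qPoch (a : ℂ) {q : ℂ} (hq1 : ‖q‖ < 1) :
    Tendsto (qPoch a q) atTop (𝓝 (qPochInf a q)) :=
  (hasProd_qPochInf a q hq1).tendsto_prod_nat

theorem qPochInf_self_ne_zero {q : ℂ} (hq1 : ‖q‖ < 1) : qPochInf q q ≠ 0 := by
  have h := tprod_one_add_ne_zero_of_summable (f := fun i : ℕ => -(q * q ^ i)) ?_ ?_
  · simpa only [qPochInf, sub_eq_add_neg] using h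
  · intro i
    rw [← sub_eq_add_neg, ← pow_succ']
    exact one_sub_pow_succ_ne_zero hq1 i
  · simp only [norm_neg, norm_mul, norm_pow]
    exact (summable_geometric_of_lt_one (norm_nonneg q) hq1).mul_left _

theorem tendsto_invPoch {q : ℂ} (hq1 : ‖q‖ < 1) :
    Tendsto (invPoch q) atTop (𝓝 (qPochInf q q)⁻¹) := by
  have h : Tendsto (fun m : ℤ => (qPoch q q m.toNat)⁻¹) atTop (𝓝 (qPochInf q q)⁻¹) := by
    refine ((tendsto_qPoch q hq1).inv₀ (qPochInf_self_ne_zero hq1)).comp ?_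
    refine tendsto_atTop.2 fun b => ?_
    filter_upwards [eventually_ge_atTop (b : ℤ)] with m hm
    omega
  refine h.congr' ?_
  filter_upwards [eventually_ge_atTop (0 : ℤ)] with m hm
  simp [invPoch, hm]

theorem exists_norm_invPoch_le {q : ℂ} (hq1 : ‖q‖ < 1) :
    ∃ C : ℝ, 1 ≤ C ∧ ∀ m : ℤ, ‖invPoch q m‖ ≤ C := by
  have h : Tendsto (fun n : ℕ => invPoch q n) atTop (𝓝 (qPochInf q q)⁻¹) :=
    (tendsto_invPoch hq1).comp tendsto_natCast_atTop_atTop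
  obtain ⟨C, hC⟩ := (Metric.isBounded_range_of_tendsto _ h).exists_norm_le
  refine ⟨max C 1, le_max_right _ _, fun m => ?_⟩
  rcases lt_or_ge m 0 with hm | hm
  · rw [invPoch_of_neg q hm, norm_zero]
    exact zero_le_one.trans (le_max_right _ _)
  · obtain ⟨n, rfl⟩ := Int.eq_ofNat_of_zero_le hm
    exact (hC _ ⟨n, rfl⟩).trans (le_max_left _ _)

theorem tendsto_invPoch_natCast_add {q : ℂ} (hq1 : ‖q‖ < 1) (a : ℤ) :
    Tendsto (fun n : ℕ => invPoch q (n + a)) atTop (𝓝 (qPochInf q q)⁻¹) :=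
  (tendsto_invPoch hq1).comp
    (tendsto_atTop_add_const_right _ a tendsto_natCast_atTop_atTop)

/-- Dominated convergence: the kernel is bounded uniformly in `n` and `p`, and tends to `1/(q)_∞^2`
for each fixed `p`. -/
theorem tendsto_tsum_kernel {q : ℂ} (hq1 : ‖q‖ < 1) {γ : ℤ → ℂ} (hγ : Summable γ) :
    Tendsto (fun n : ℕ => ∑' p : ℤ, γ p * kernel q 0 n p) atTop
      (𝓝 ((∑' p : ℤ, γ p) * ((qPochInf q q)⁻¹ * (qPochInf q q)⁻¹))) := by
  obtain ⟨C, hC1, hC⟩ := exists_norm_invPoch_le hq1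
  rw [← tsum_mul_right]
  refine tendsto_tsum_of_dominated_convergence (bound := fun p => ‖γ p‖ * (C * C))
    (hγ.norm.mul_right _) (fun p => ?_) (Eventually.of_forall fun n p => ?_)
  · refine tendsto_const_nhds.mul ?_
    have h1 := tendsto_invPoch_natCast_add hq1 (-p)
    have h2 := tendsto_invPoch_natCast_add hq1 p
    refine (h1.mul h2).congr fun n => ?_
    rw [kernel, add_zero, sub_eq_add_neg]
  · rw [kernel, norm_mul, norm_mul]
    gcongr
    · exact hC _
    · exact hC _

theorem summable_zpow_mul_zpow_tri {q z : ℂ} (hq0 : q ≠ 0) (hq1 : ‖q‖ < 1) (hz : z ≠ 0) :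
    Summable (fun p : ℤ => z ^ p * q ^ tri p) := by
  have hpow : Tendsto (fun n : ℕ => ‖q‖ ^ n) atTop (𝓝 0) :=
    tendsto_pow_atTop_nhds_zero_of_lt_one (norm_nonneg q) hq1
  refine Summable.of_nat_of_neg ?_ ?_
  · refine summable_of_ratio_test_tendsto_lt_one zero_lt_one (Eventually.of_forall fun n =>
      mul_ne_zero (zpow_ne_zero _ hz) (zpow_ne_zero _ hq0)) ?_
    have h := hpow.const_mul ‖z‖
    rw [mul_zero] at h
    refine h.congr fun n => ?_
    rw [← norm_div, ← norm_pow, ← norm_mul]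
    congr 1
    rw [Nat.cast_succ, tri_add_one, zpow_add_one₀ hz, zpow_add₀ hq0, zpow_natCast, zpow_natCast]
    have h1 : z ^ n ≠ 0 := pow_ne_zero _ hz
    have h2 : q ^ tri n ≠ 0 := zpow_ne_zero _ hq0
    field_simp
  · refine summable_of_ratio_test_tendsto_lt_one zero_lt_one (Eventually.of_forall fun n =>
      mul_ne_zero (zpow_ne_zero _ hz) (zpow_ne_zero _ hq0)) ?_
    have h := hpow.const_mul ‖z⁻¹ * q‖
    rw [mul_zero] at h
    refine h.congr fun n => ?_
    rw [← norm_div, ← norm_pow, ← norm_mul]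
    congr 1
    have e1 : tri (-((n + 1 : ℕ) : ℤ)) = tri (-n) + (n + 1 : ℕ) := by
      have := tri_add_one (-((n + 1 : ℕ) : ℤ))
      rw [show -((n + 1 : ℕ) : ℤ) + 1 = -n by push_cast; ring] at this
      rw [this]
      ring
    have e2 : z ^ (-((n + 1 : ℕ) : ℤ)) = z ^ (-(n : ℤ)) * z⁻¹ := by
      rw [← zpow_sub_one₀ hz]
      congr 1
      push_cast
      ring
    rw [e1, e2, zpow_add₀ hq0, zpow_natCast]
    have h1 : z ^ (-(n : ℤ)) ≠ 0 := zpow_ne_zero _ hz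
    have h2 : q ^ tri (-(n : ℤ)) ≠ 0 := zpow_ne_zero _ hq0
    field_simp
    ring

/-- The Jacobi triple product identity. -/
theorem hasSum_jacobi {q z : ℂ} (hq0 : q ≠ 0) (hq1 : ‖q‖ < 1) (hz : z ≠ 0) :
    HasSum (fun p : ℤ => (-z) ^ p * q ^ tri p)
      (qPochInf z q * qPochInf (q / z) q * qPochInf q q) := by
  have hs := summable_zpow_mul_zpow_tri hq0 hq1 (neg_ne_zero.2 hz)
  have h1 := tendsto_tsum_kernel hq1 hs
  have h2 : Tendsto (fun n : ℕ => qPoch z q n * qPoch (q / z) q n * invPoch q (2 * n : ℕ)) atTop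
      (𝓝 (qPochInf z q * qPochInf (q / z) q * (qPochInf q q)⁻¹)) := by
    refine ((tendsto_qPoch z hq1).mul (tendsto_qPoch _ hq1)).mul ((tendsto_invPoch hq1).comp ?_)
    refine tendsto_natCast_atTop_atTop.comp ?_
    exact tendsto_atTop_mono (fun n => show id n ≤ 2 * n by rw [id]; omega) tendsto_id
  simp only [(hasSum_finite_jacobi hq0 hq1 hz _).tsum_eq] at h1
  have h3 := tendsto_nhds_unique h1 h2
  have hE := qPochInf_self_ne_zero hq1
  have h4 : ∑' p : ℤ, (-z) ^ p * q ^ tri p =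
      qPochInf z q * qPochInf (q / z) q * qPochInf q q := by
    field_simp at h3
    linear_combination h3
  rw [← h4]
  exact hs.hasSum

/-! ### Bilateral Bailey pairs -/

/-- `(α, β)` is a bilateral Bailey pair relative to `q ^ c`. -/
def IsBaileyPair (q : ℂ) (c : ℕ) (α : ℤ → ℂ) (β : ℕ → ℂ) : Prop :=
  ∀ n : ℕ, HasSum (fun p : ℤ => α p * kernel q c n p) (β n)

/-- The finite triple product at `z = 1`, where `(1; q)_n` vanishes unless `n = 0`. -/
theorem isBaileyPair_unit {q : ℂ} (hq0 : q ≠ 0) (hq1 : ‖q‖ < 1) :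
    IsBaileyPair q 0 (fun p => (-1) ^ p * q ^ tri p) (fun n => if n = 0 then 1 else 0) := by
  intro n
  have h := hasSum_finite_jacobi hq0 hq1 one_ne_zero n
  have hval : (if n = 0 then (1 : ℂ) else 0) =
      qPoch 1 q n * qPoch (q / 1) q n * invPoch q (2 * n : ℕ) := by
    rcases Nat.eq_zero_or_pos n with rfl | hn
    · simp [qPoch_zero, invPoch_zero]
    · have : qPoch 1 q n = 0 := prod_eq_zero (mem_range.2 hn) (by simp)
      rw [this, if_neg hn.ne']
      ring
  simpa only [hval, Nat.cast_zero] using h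

theorem hasSum_zero_of_antisymm {D : ℤ → ℂ} (hs : Summable D)
    (hD : ∀ p, D (-1 - p) = -D p) : HasSum D 0 := by
  have h1 := hs.hasSum
  have h2 := (Equiv.subLeft (-1 : ℤ)).hasSum_iff.2 h1
  have h3 : D ∘ Equiv.subLeft (-1 : ℤ) = fun p => -D p := by
    ext p
    simp [hD]
  rw [h3] at h2
  have h4 := h2.unique h1.neg
  have h5 : ∑' p, D p = 0 := self_eq_neg.1 h4
  rwa [h5] at h1

theorem summable_mul_kernel (q : ℂ) (c n : ℕ) (f : ℤ → ℂ) :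
    Summable (fun p : ℤ => f p * kernel q c n p) := by
  refine summable_of_ne_finset_zero (s := Icc (-(n : ℤ) - c) n) fun p hp => ?_
  rw [mem_Icc, not_and_or] at hp
  rcases hp with hp | hp
  · rw [kernel_eq_zero_of_add_neg q (by omega), mul_zero]
  · rw [kernel_eq_zero_of_lt q (by omega), mul_zero]

/-- For these `α`, being a Bailey pair relative to `1` and relative to `q` is the same. -/
theorem isBaileyPair_zero_iff_one {q : ℂ} (hq0 : q ≠ 0) (hq1 : ‖q‖ < 1) {α : ℤ → ℂ} {β : ℕ → ℂ}
    (hα : ∀ p, α (-1 - p) = -(q ^ (2 * p + 1) * α p)) :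
    IsBaileyPair q 0 α β ↔ IsBaileyPair q 1 α β := by
  refine forall_congr' fun n => ?_
  -- The two kernels differ by `q^{n+p+1}` times the `c = 1` kernel. Multiplied by `α`, this
  -- difference is odd under `p ↦ -1-p`, so it sums to zero.
  have hD : HasSum (fun p : ℤ => α p * q ^ (n + p + 1) * kernel q 1 n p) 0 := by
    refine hasSum_zero_of_antisymm ?_ fun p => ?_
    · exact_mod_cast summable_mul_kernel q 1 n fun p => α p * q ^ (n + p + 1)
    · have h := kernel_symm q 1 n p
      rw [show -p - 1 = -1 - p by ring] at h
      rw [h, hα]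
      have e : q ^ (n + p + 1) = q ^ (2 * p + 1) * q ^ ((n : ℤ) + (-1 - p) + 1) := by
        rw [← zpow_add₀ hq0]
        congr 1
        ring
      rw [e]
      ring
  have hk : ∀ p : ℤ, α p * kernel q 0 n p =
      α p * kernel q 1 n p - α p * q ^ (n + p + 1) * kernel q 1 n p := by
    intro p
    have h := invPoch_sub_one hq1 ((n : ℤ) + p + 1)
    rw [show (n : ℤ) + p + 1 - 1 = n + p + 0 by ring] at h
    rw [kernel, kernel, h]
    ring
  constructor
  · intro h
    have h' := h.add hD
    rw [add_zero] at h'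
    refine h'.congr_fun fun p => ?_
    simp only [Nat.cast_zero, Nat.cast_one]
    rw [hk]
    ring
  · intro h
    have h' := h.sub hD
    rw [sub_zero] at h'
    refine h'.congr_fun fun p => ?_
    simp only [Nat.cast_zero, Nat.cast_one]
    rw [hk]

theorem IsBaileyPair.step {q : ℂ} (hq0 : q ≠ 0) (hq1 : ‖q‖ < 1) {c : ℕ} (hc : c ≤ 1)
    {α : ℤ → ℂ} {β : ℕ → ℂ} (h : IsBaileyPair q c α β) :
    IsBaileyPair q c (fun p => q ^ (p ^ 2 + c * p) * α p)
      (fun L => ∑ n ∈ range (L + 1), q ^ ((n : ℤ) ^ 2 + c * n) * invPoch q (L - n) * β n) := by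
  intro L
  have h1 := hasSum_sum (s := range (L + 1)) fun n _ =>
    (h n).mul_left (q ^ ((n : ℤ) ^ 2 + c * n) * invPoch q (L - n))
  refine h1.congr_fun fun p => ?_
  rw [mul_right_comm, ← sum_kernel hq0 hq1 hc p L le_rfl, sum_mul]
  exact sum_congr rfl fun n _ => by ring

theorem IsBaileyPair.step_binom {q : ℂ} (hq0 : q ≠ 0) (hq1 : ‖q‖ < 1)
    {α : ℤ → ℂ} {β : ℕ → ℂ} (h : IsBaileyPair q 0 α β) :
    IsBaileyPair q 0 (fun p => q ^ (p ^ 2) * (q ^ p + q ^ (-p)) * α p)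
      (fun L => ∑ n ∈ range (L + 1), q ^ ((n : ℤ) ^ 2) * (q ^ (-(n : ℤ)) * (1 + q ^ (L + n))) *
        invPoch q (L - n) * β n) := by
  intro L
  have h1 := hasSum_sum (s := range (L + 1)) fun n _ =>
    (h n).mul_left (q ^ ((n : ℤ) ^ 2) * (q ^ (-(n : ℤ)) * (1 + q ^ (L + n))) * invPoch q (L - n))
  refine h1.congr_fun fun p => ?_
  have key := sum_kernel_binom hq0 hq1 p L le_rfl
  simp only [Nat.cast_zero]
  rw [mul_right_comm, ← key, sum_mul]
  refine sum_congr rfl fun n _ => ?_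
  rw [← Nat.cast_add, zpow_natCast]
  ring

/-! ### Iterated sums over chains -/

/-- The sequence `L, s_1, …, s_k, 0, 0, …`. -/
def extend {k : ℕ} (L : ℕ) (s : Fin k → ℕ) : ℕ → ℕ
  | 0 => L
  | i + 1 => if h : i < k then s ⟨i, h⟩ else 0

/-- The summand of an iterated sum with step weights `g i s_i s_{i+1}`, where `s_0 = L`. -/
def chainTerm (q : ℂ) (g : ℕ → ℕ → ℕ → ℂ) {k : ℕ} (L : ℕ) (s : Fin k → ℕ) : ℂ :=
  (∏ i ∈ range k, g i (extend L s i) (extend L s (i + 1)) *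
    invPoch q (extend L s i - extend L s (i + 1))) * invPoch q (extend L s k)

theorem extend_cons {k : ℕ} (L n : ℕ) (s : Fin k → ℕ) (i : ℕ) :
    extend L (Fin.cons n s : Fin (k + 1) → ℕ) (i + 1) = extend n s i := by
  cases i with
  | zero => simp [extend]
  | succ i =>
    by_cases h : i < k
    · simp only [extend, Nat.add_lt_add_iff_right, h, dite_true]
      rfl
    · simp [extend, h]

theorem chainTerm_cons (q : ℂ) (g : ℕ → ℕ → ℕ → ℂ) {k : ℕ} (L n : ℕ) (s : Fin k → ℕ) :
    chainTerm q g L (Fin.cons n s : Fin (k + 1) → ℕ) =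
      g 0 L n * invPoch q (L - n) * chainTerm q (fun i => g (i + 1)) n s := by
  rw [chainTerm, prod_range_succ']
  simp only [extend_cons, chainTerm]
  simp only [extend]
  ring

/-- Peels off the outermost variable `s_1 = n`. The sum over `n` is finite because `invPoch q (L -
n)` vanishes for `n > L`. -/
theorem hasSum_chainTerm_succ {q : ℂ} {g : ℕ → ℕ → ℕ → ℂ} {k : ℕ} {β : ℕ → ℂ}
    (h : ∀ n, HasSum (fun s : Fin k → ℕ => chainTerm q (fun i => g (i + 1)) n s) (β n)) (L : ℕ) :
    HasSum (fun s : Fin (k + 1) → ℕ => chainTerm q g L s)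
      (∑ n ∈ range (L + 1), g 0 L n * invPoch q (L - n) * β n) := by
  rw [← (Fin.consEquiv fun _ : Fin (k + 1) => ℕ).hasSum_iff]
  have h1 : ∀ n ∈ range (L + 1), HasSum (fun x : ℕ × (Fin k → ℕ) => if x.1 = n then
      g 0 L n * invPoch q (L - n) * chainTerm q (fun i => g (i + 1)) n x.2 else 0)
      (g 0 L n * invPoch q (L - n) * β n) := by
    intro n _
    rw [← (Prod.mk_right_injective n).hasSum_iff]
    · simpa [Function.comp_def] using (h n).mul_left _
    · rintro ⟨m, s⟩ hx
      refine if_neg ?_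
      rintro rfl
      exact hx ⟨s, rfl⟩
  refine (hasSum_sum h1).congr_fun ?_
  rintro ⟨m, s⟩
  simp only [Function.comp, Fin.consEquiv, Equiv.coe_fn_mk, chainTerm_cons, sum_ite_eq, mem_range]
  split_ifs with hm
  · rfl
  · rw [invPoch_of_neg q (by omega)]
    ring

open Classical in
/-- The step weights of the Andrews–Gordon sums: in the first `t` steps `q ^ (n ^ 2)`, with a
binomial factor where `χ` holds, and `q ^ (n ^ 2 + n)` afterwards. -/
def weight (q : ℂ) (t : ℕ) (χ : ℕ → Prop) (i L n : ℕ) : ℂ :=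
  if i < t then q ^ ((n : ℤ) ^ 2) * (if χ i then q ^ (-(n : ℤ)) * (1 + q ^ (L + n)) else 1)
  else q ^ ((n : ℤ) ^ 2 + n)

theorem weight_shift (q : ℂ) (t : ℕ) (χ : ℕ → Prop) :
    (fun i => weight q (t + 1) χ (i + 1)) = weight q t fun i => χ (i + 1) := by
  ext i L n
  simp [weight]

theorem weight_zero_shift (q : ℂ) (χ : ℕ → Prop) :
    (fun i => weight q 0 χ (i + 1)) = weight q 0 χ := by
  ext i L n
  simp [weight]

/-- The `α` side of the `q ^ (n ^ 2 + n)` steps. -/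
def alphaLinear (q : ℂ) (r : ℕ) (p : ℤ) : ℂ :=
  (q ^ (p ^ 2 + p)) ^ (r + 1) * ((-1) ^ p * q ^ tri p)

/-- `q^{p^2+p}` is invariant under `p ↦ -1-p`, so only the sign and the triangular exponent change.
The free exponent `r` covers both the unit pair (`r = 0`) and `alphaLinear`. -/
theorem alphaLinear_antisymm {q : ℂ} (hq0 : q ≠ 0) (r : ℕ) (p : ℤ) :
    (q ^ (p ^ 2 + p)) ^ r * ((-1) ^ (-1 - p) * q ^ tri (-1 - p)) =
      -(q ^ (2 * p + 1) * ((q ^ (p ^ 2 + p)) ^ r * ((-1) ^ p * q ^ tri p))) := by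
  have e2 : tri (-1 - p) = tri p + (2 * p + 1) := by
    have h1 := two_mul_tri (-1 - p)
    have h2 := two_mul_tri p
    exact mul_left_cancel₀ (two_ne_zero (α := ℤ)) (by linear_combination h1 - h2)
  have e3 : (-1 : ℂ) ^ (-1 - p) = -(-1) ^ p := by
    rw [zpow_sub₀ (by norm_num)]
    rcases Int.even_or_odd p with h | h
    · simp [h.neg_one_zpow]
    · simp [h.neg_one_zpow]
  rw [e2, e3, zpow_add₀ hq0 (tri p)]
  ring

theorem exists_isBaileyPair_linear {q : ℂ} (hq0 : q ≠ 0) (hq1 : ‖q‖ < 1) (χ : ℕ → Prop) (r : ℕ) :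
    ∃ β : ℕ → ℂ, (∀ L, HasSum (fun s : Fin r → ℕ => chainTerm q (weight q 0 χ) L s) (β L)) ∧
      IsBaileyPair q 1 (alphaLinear q r) β := by
  induction r with
  | zero =>
    refine ⟨fun L => invPoch q L, fun L => ?_, ?_⟩
    · convert hasSum_fintype (fun s : Fin 0 → ℕ => chainTerm q (weight q 0 χ) L s) using 1
      simp [chainTerm, extend]
    -- One Bailey step is spent before any chain variable appears: applied to the delta sequence it
    -- yields `1/(q)_L`, the innermost factor of a chain term. Hence the exponent `r + 1` in
    -- `alphaLinear`.
    · have h := (isBaileyPair_zero_iff_one hq0 hq1 (fun p => by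
        simpa using alphaLinear_antisymm hq0 0 p)).1 (isBaileyPair_unit hq0 hq1)
      have h' := h.step hq0 hq1 le_rfl
      have hα : alphaLinear q 0 = fun p : ℤ =>
          q ^ (p ^ 2 + (1 : ℕ) * p) * ((-1 : ℂ) ^ p * q ^ tri p) := by
        ext p
        simp [alphaLinear]
      rw [hα]
      convert h' using 2 with L
      simp
  | succ r ih =>
    obtain ⟨β, hβ, hp⟩ := ih
    rw [← weight_zero_shift] at hβ
    refine ⟨_, hasSum_chainTerm_succ hβ, ?_⟩
    convert hp.step hq0 hq1 le_rfl using 1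
    · ext p
      simp only [alphaLinear, Nat.cast_one, one_mul]
      ring
    · simp [weight]

open Classical in
/-- The `α` side of the iterated sum. -/
def alphaChain (q : ℂ) (t : ℕ) (χ : ℕ → Prop) (r : ℕ) (p : ℤ) : ℂ :=
  (∏ i ∈ range t, q ^ (p ^ 2) * (if χ i then q ^ p + q ^ (-p) else 1)) * alphaLinear q r p

/-- The outermost chain variable is the last Bailey step, so induction on `t` shifts `χ` by one. The
base case is where the pair passes from `c = 1` back to `c = 0`, before any `q^{p^2}` step can spoil
the reflection symmetry. -/
theorem exists_isBaileyPair_chain {q : ℂ} (hq0 : q ≠ 0) (hq1 : ‖q‖ < 1) (t r : ℕ) {k : ℕ}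
    (hk : k = t + r) (χ : ℕ → Prop) :
    ∃ β : ℕ → ℂ, (∀ L, HasSum (fun s : Fin k → ℕ => chainTerm q (weight q t χ) L s) (β L)) ∧
      IsBaileyPair q 0 (alphaChain q t χ r) β := by
  induction t generalizing k χ with
  | zero =>
    obtain rfl : k = r := by omega
    obtain ⟨β, hβ, hp⟩ := exists_isBaileyPair_linear hq0 hq1 χ k
    refine ⟨β, hβ, ?_⟩
    have hα : alphaChain q 0 χ k = alphaLinear q k := by
      ext p
      simp [alphaChain]
    rw [hα]
    refine (isBaileyPair_zero_iff_one hq0 hq1 fun p => ?_).2 hp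
    have e : (-1 - p) ^ 2 + (-1 - p) = p ^ 2 + p := by ring
    rw [alphaLinear, alphaLinear, e]
    exact alphaLinear_antisymm hq0 (k + 1) p
  | succ t ih =>
    obtain ⟨m, rfl⟩ : ∃ m, k = m + 1 := ⟨t + r, by omega⟩
    obtain ⟨β, hβ, hp⟩ := ih (k := m) (by omega) fun i => χ (i + 1)
    rw [← weight_shift] at hβ
    refine ⟨_, hasSum_chainTerm_succ hβ, ?_⟩
    by_cases h : χ 0
    · convert hp.step_binom hq0 hq1 using 1
      · ext p
        simp only [alphaChain, prod_range_succ', if_pos h]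
        ring
      · simp [weight, h]
    · convert hp.step hq0 hq1 zero_le_one using 1
      · ext p
        simp only [alphaChain, prod_range_succ', if_neg h, Nat.cast_zero, zero_mul, add_zero]
        ring
      · simp [weight, h]

/-! ### Summability of the chain sums -/

theorem summable_prod_pi {h : ℕ → ℝ} (h0 : ∀ n, 0 ≤ h n) (hs : Summable h) (k : ℕ) :
    Summable (fun s : Fin k → ℕ => ∏ i, h (s i)) := by
  induction k with
  | zero => exact (hasSum_fintype _).summable
  | succ k ih =>
    rw [← (Fin.consEquiv fun _ : Fin (k + 1) => ℕ).summable_iff]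
    refine (hs.mul_of_nonneg ih h0 fun s => prod_nonneg fun i _ => h0 _).congr fun x => ?_
    simp [Fin.consEquiv, Fin.prod_univ_succ]

theorem summable_norm_zpow_sq_sub {q : ℂ} (hq0 : q ≠ 0) (hq1 : ‖q‖ < 1) :
    Summable (fun n : ℕ => ‖q‖ ^ ((n : ℤ) ^ 2 - n)) := by
  -- As `n^2 - n = 2 tri n`, this is half of a theta series in base `q^2`.
  have h1 : ‖q ^ 2‖ < 1 := by
    rw [norm_pow]
    exact pow_lt_one₀ (norm_nonneg q) hq1 two_ne_zero
  have h2 := (summable_zpow_mul_zpow_tri (pow_ne_zero 2 hq0) h1 one_ne_zero).norm.comp_injective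
    Nat.cast_injective
  refine h2.congr fun n => ?_
  simp only [Function.comp, one_zpow, one_mul]
  rw [norm_zpow, norm_pow, ← zpow_natCast, ← zpow_mul]
  congr 1
  have := two_mul_tri n
  push_cast
  rw [this]
  ring

theorem norm_weight_le {q : ℂ} (hq0 : q ≠ 0) (hq1 : ‖q‖ < 1) (t : ℕ) (χ : ℕ → Prop)
    (i L n : ℕ) : ‖weight q t χ i L n‖ ≤ 2 * ‖q‖ ^ ((n : ℤ) ^ 2 - n) := by
  have hq : 0 < ‖q‖ := norm_pos_iff.2 hq0
  have hmono : ∀ m : ℕ, ‖q‖ ^ ((n : ℤ) ^ 2 - n + m) ≤ 2 * ‖q‖ ^ ((n : ℤ) ^ 2 - n) := by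
    intro m
    rw [zpow_add₀ hq.ne', zpow_natCast]
    have h1 : ‖q‖ ^ m ≤ 1 := pow_le_one₀ hq.le hq1.le
    have h2 : 0 < ‖q‖ ^ ((n : ℤ) ^ 2 - n) := zpow_pos hq _
    nlinarith
  rw [weight]
  split_ifs with h1 h2
  · rw [← mul_assoc, ← zpow_add₀ hq0, norm_mul, norm_zpow, ← sub_eq_add_neg, mul_comm]
    gcongr
    refine (norm_add_le _ _).trans ?_
    rw [norm_one, norm_pow]
    have : ‖q‖ ^ (L + n) ≤ 1 := pow_le_one₀ hq.le hq1.le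
    linarith
  · rw [mul_one, norm_zpow]
    convert hmono n using 2
    ring
  · rw [norm_zpow]
    convert hmono (2 * n) using 2
    push_cast
    ring

/-- The bound must not depend on `L`, so that it serves as a dominating function for `L → ∞`. It is
a product of one-variable bounds `2C ‖q‖^{n^2-n}`, times `C`. -/
theorem exists_bound_chainTerm {q : ℂ} (hq0 : q ≠ 0) (hq1 : ‖q‖ < 1) (t : ℕ) (χ : ℕ → Prop)
    (k : ℕ) : ∃ bound : (Fin k → ℕ) → ℝ, Summable bound ∧
      ∀ L s, ‖chainTerm q (weight q t χ) L s‖ ≤ bound s := by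
  obtain ⟨C, hC1, hC⟩ := exists_norm_invPoch_le hq1
  have hC0 : 0 ≤ C := zero_le_one.trans hC1
  have hz : ∀ n : ℕ, 0 ≤ ‖q‖ ^ ((n : ℤ) ^ 2 - n) := fun n => zpow_nonneg (norm_nonneg q) _
  refine ⟨fun s => (∏ i, 2 * ‖q‖ ^ ((s i : ℤ) ^ 2 - s i) * C) * C, ?_, fun L s => ?_⟩
  · refine Summable.mul_right _ (summable_prod_pi (h := fun n : ℕ => 2 * ‖q‖ ^ ((n : ℤ) ^ 2 - n) * C)
      (fun n => ?_) ?_ k)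
    · have := hz n
      positivity
    · exact ((summable_norm_zpow_sq_sub hq0 hq1).mul_left 2).mul_right C
  · have hprod : ∏ i, 2 * ‖q‖ ^ ((s i : ℤ) ^ 2 - s i) * C = ∏ i ∈ range k,
        2 * ‖q‖ ^ ((extend L s (i + 1) : ℤ) ^ 2 - extend L s (i + 1)) * C := by
      rw [prod_range]
      simp [extend]
    simp only [hprod]
    rw [chainTerm, norm_mul, norm_prod]
    refine mul_le_mul (prod_le_prod (fun i _ => norm_nonneg _) fun i _ => ?_) (hC _)
      (norm_nonneg _) (prod_nonneg fun i _ => ?_)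
    · rw [norm_mul]
      have := hz (extend L s (i + 1))
      exact mul_le_mul (norm_weight_le hq0 hq1 t χ _ _ _) (hC _) (norm_nonneg _) (by positivity)
    · have := hz (extend L s (i + 1))
      positivity

/-! ### Identification of the summand -/

theorem prod_Icc_one (f : ℕ → ℂ) (k : ℕ) : ∏ i ∈ Icc 1 k, f i = ∏ i ∈ range k, f (i + 1) := by
  rw [range_eq_Ico, prod_Ico_add' f 0 k 1]
  rfl

theorem part_eq_extend {k : ℕ} (s : Chain k) (L i : ℕ) : s.part (i + 1) = extend L s.1 (i + 1) := by
  simp only [Chain.part, extend]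
  by_cases h : i < k
  · rw [dif_pos h, dif_pos (by omega)]
    rfl
  · rw [dif_neg h, dif_neg (by omega)]

theorem part_succ_le {k : ℕ} (s : Chain k) (i : ℕ) : s.part (i + 2) ≤ s.part (i + 1) := by
  unfold Chain.part
  split_ifs with h1 h2
  · exact s.2 (by simp)
  · omega
  · omega
  · omega

theorem agTerm_eq_prod (q : ℂ) {k r : ℕ} (s : Chain k) :
    agTerm q k r s = ∏ i ∈ range k, (q ^ (s.part (i + 1) ^ 2) *
      (if i < k - r then 1 else q ^ s.part (i + 1)) *
      invPoch q (s.part (i + 1) - s.part (i + 2))) := by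
  have h1 : ∑ i ∈ Icc (k - r + 1) k, s.part i =
      ∑ i ∈ Icc 1 k, if ¬i - 1 < k - r then s.part i else 0 := by
    rw [← sum_filter]
    refine sum_congr ?_ fun _ _ => rfl
    ext i
    simp only [mem_Icc, mem_filter]
    omega
  rw [agTerm, h1, ← sum_add_distrib, ← prod_pow_eq_pow_sum, ← prod_div_distrib, prod_Icc_one]
  refine prod_congr rfl fun i _ => ?_
  rw [← Nat.cast_sub (part_succ_le s i), invPoch_natCast, Nat.add_sub_cancel, pow_add,
    div_eq_mul_inv]
  split_ifs <;> simp

theorem prod_binomFactor {q : ℂ} {k r : ℕ} {S : Finset ℕ} (hS : S ⊆ Icc 1 (k - r)) (s : Chain k) :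
    ∏ i ∈ S, binomFactor q s i =
      ∏ i ∈ range k, if i + 1 ∈ S then binomFactor q s (i + 1) else 1 := by
  rw [← prod_Icc_one (fun i => if i ∈ S then binomFactor q s i else 1), prod_ite_mem]
  congr 1
  exact (inter_eq_right.2 (hS.trans (Icc_subset_Icc_right (Nat.sub_le k r)))).symm

/-- Isolates the dependence on `L`. A step at `i = 1` carries `1 + q^{L+s_1}`, which `binomFactor`
lacks there; this factor tends to `1`. -/
theorem chainTerm_chain {q : ℂ} (hq0 : q ≠ 0) {k r : ℕ} {S : Finset ℕ}
    (hS : S ⊆ Icc 1 (k - r)) (s : Chain k) (L : ℕ) :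
    chainTerm q (weight q (k - r) fun i => i + 1 ∈ S) L s.1 =
      (∏ i ∈ S, binomFactor q s i) * agTerm q k r s *
        (invPoch q (L - s.part 1) * if 1 ∈ S then 1 + q ^ (L + s.part 1) else 1) := by
  have hinv : (∏ i ∈ range k, invPoch q (extend L s.1 i - extend L s.1 (i + 1))) *
      invPoch q (extend L s.1 k) = invPoch q (L - s.part 1) *
        ∏ i ∈ range k, invPoch q (s.part (i + 1) - s.part (i + 2)) := by
    -- The consecutive differences of `L, s_1, …, s_k, 0` are multiplied once with the last factor
    -- split off and once with the first.
    have h1 := prod_range_succ (fun i => invPoch q (extend L s.1 i - extend L s.1 (i + 1))) k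
    have h2 := prod_range_succ' (fun i => invPoch q (extend L s.1 i - extend L s.1 (i + 1))) k
    have h3 : extend L s.1 (k + 1) = 0 := by simp [extend]
    rw [h3, Nat.cast_zero, sub_zero] at h1
    rw [← h1, h2, mul_comm]
    simp only [part_eq_extend s L]
    rfl
  have hw : ∏ i ∈ range k, weight q (k - r) (fun i => i + 1 ∈ S) i (extend L s.1 i)
        (extend L s.1 (i + 1)) =
      (∏ i ∈ range k, q ^ (s.part (i + 1) ^ 2) *
        (if i < k - r then 1 else q ^ s.part (i + 1)) *
        (if i + 1 ∈ S then binomFactor q s (i + 1) else 1)) *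
        if 1 ∈ S then 1 + q ^ (L + s.part 1) else 1 := by
    have hc : (if 1 ∈ S then 1 + q ^ (L + s.part 1) else 1) =
        ∏ i ∈ range k, if i = 0 then (if 1 ∈ S then 1 + q ^ (L + s.part 1) else 1) else 1 := by
      rw [prod_ite_eq' (range k) 0 fun _ => if 1 ∈ S then 1 + q ^ (L + s.part 1) else 1]
      by_cases h : 1 ∈ S
      · have := mem_Icc.1 (hS h)
        rw [if_pos (mem_range.2 (by omega))]
      · simp [h]
    rw [hc, ← prod_mul_distrib]
    refine prod_congr rfl fun i _ => ?_
    rw [← part_eq_extend s L, weight]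
    have hsq : q ^ ((s.part (i + 1) : ℤ) ^ 2) = q ^ (s.part (i + 1) ^ 2) := by
      rw [← zpow_natCast]
      push_cast
      rfl
    by_cases hi : i < k - r
    · rw [if_pos hi, if_pos hi, hsq]
      by_cases hm : i + 1 ∈ S
      · rw [if_pos hm, if_pos hm]
        cases i with
        | zero =>
          simp only [zero_add] at hm
          simp [binomFactor, hm, extend]
          ring
        | succ i =>
          rw [if_neg (Nat.succ_ne_zero i), ← part_eq_extend s L]
          simp [binomFactor]
      · rw [if_neg hm, if_neg hm]
        split_ifs with h0 h1
        · subst h0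
          exact absurd h1 hm
        · ring
        · ring
    · have hm : i + 1 ∉ S := fun h => hi (by have := mem_Icc.1 (hS h); omega)
      rw [if_neg hi, if_neg hi, if_neg hm, zpow_add₀ hq0, hsq, zpow_natCast]
      split_ifs with h0 h1
      · subst h0
        exact absurd h1 hm
      · ring
      · ring
  rw [chainTerm, prod_mul_distrib, mul_assoc, hinv, hw, agTerm_eq_prod, prod_binomFactor hS]
  simp only [prod_mul_distrib]
  ring

/-- An ascent `s_i < s_{i+1}` makes an `invPoch` vanish, so sums over all tuples are sums over
chains. -/
theorem chainTerm_of_not_antitone (q : ℂ) (g : ℕ → ℕ → ℕ → ℂ) {k : ℕ} (L : ℕ) {s : Fin k → ℕ}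
    (hs : ¬Antitone s) : chainTerm q g L s = 0 := by
  by_contra hne
  apply hs
  rw [chainTerm] at hne
  have hprod := prod_ne_zero_iff.1 (left_ne_zero_of_mul hne)
  have hanti : Antitone fun i => extend L s (i + 1) := by
    refine antitone_nat_of_succ_le fun i => ?_
    by_cases hi : i + 1 < k
    · by_contra hlt
      refine right_ne_zero_of_mul (hprod (i + 1) (mem_range.2 hi)) (invPoch_of_neg q ?_)
      omega
    · simp [extend, hi]
  intro a b hab
  have h := hanti (Fin.le_def.1 hab)
  simpa [extend] using h

/-! ### The limit `L → ∞` -/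

/-- Since `p^2 = 2 tri p + p`, the `m`-th term of the expanded `(q^p + q^{-p})^j` is a theta series
in base `q^{2k+3}` with `z = q^{k+2+r-j+2m}`. -/
theorem hasSum_alphaChain {q : ℂ} (hq0 : q ≠ 0) (hq1 : ‖q‖ < 1) {k r j : ℕ}
    (hjr : j + r ≤ k) {S : Finset ℕ} (hS : S ⊆ Icc 1 (k - r)) (hj : S.card = j) :
    HasSum (alphaChain q (k - r) (fun i => i + 1 ∈ S) r)
      (productSide q k r j * qPochInf q q) := by
  have hQ0 : q ^ (2 * k + 3) ≠ 0 := pow_ne_zero _ hq0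
  have hQ1 : ‖q ^ (2 * k + 3)‖ < 1 := by
    rw [norm_pow]
    exact pow_lt_one₀ (norm_nonneg q) hq1 (by omega)
  have hJ := hasSum_sum (s := range (j + 1)) fun m _ =>
    (hasSum_jacobi hQ0 hQ1 (zpow_ne_zero ((k : ℤ) + 2 + r - j + 2 * m) hq0)).mul_left
      (j.choose m : ℂ)
  have hval : productSide q k r j * qPochInf q q = ∑ m ∈ range (j + 1), (j.choose m : ℂ) *
      (qPochInf (q ^ ((k : ℤ) + 2 + r - j + 2 * m)) (q ^ (2 * k + 3)) *
        qPochInf (q ^ (2 * k + 3) / q ^ ((k : ℤ) + 2 + r - j + 2 * m)) (q ^ (2 * k + 3)) *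
        qPochInf (q ^ (2 * k + 3)) (q ^ (2 * k + 3))) := by
    rw [productSide, sum_mul]
    refine sum_congr rfl fun m _ => ?_
    have hE := qPochInf_self_ne_zero hq1
    have e : q ^ (2 * k + 3) / q ^ ((k : ℤ) + 2 + r - j + 2 * m) =
        q ^ ((k : ℤ) + 1 - r + j - 2 * m) := by
      rw [← zpow_natCast q (2 * k + 3), ← zpow_sub₀ hq0]
      congr 1
      push_cast
      ring
    rw [e]
    field_simp
  rw [hval]
  refine hJ.congr_fun fun p => ?_
  have hpow : ∏ i ∈ range (k - r), (if i + 1 ∈ S then q ^ p + q ^ (-p) else 1) =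
      (q ^ p + q ^ (-p)) ^ j := by
    rw [← prod_Icc_one (fun i => if i ∈ S then q ^ p + q ^ (-p) else 1), prod_ite_mem,
      inter_eq_right.2 hS, prod_const, hj]
  have hα : alphaChain q (k - r) (fun i => i + 1 ∈ S) r p = (∏ i ∈ range (k - r),
      q ^ (p ^ 2) * (if i + 1 ∈ S then q ^ p + q ^ (-p) else 1)) * alphaLinear q r p := by
    unfold alphaChain
    congr!
  rw [hα, prod_mul_distrib, prod_const, card_range, alphaLinear, hpow, add_pow, mul_sum, sum_mul]
  refine sum_congr rfl fun m hm => ?_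
  have hmj : m ≤ j := by
    have := mem_range.1 hm
    omega
  have e1 : (-q ^ ((k : ℤ) + 2 + r - j + 2 * m)) ^ p =
      (-1) ^ p * q ^ (((k : ℤ) + 2 + r - j + 2 * m) * p) := by
    rw [neg_eq_neg_one_mul, mul_zpow, ← zpow_mul]
  have e2 : (q ^ (2 * k + 3)) ^ tri p = q ^ ((2 * k + 3 : ℕ) * tri p) := by
    rw [zpow_mul, zpow_natCast]
  have e3 : (q ^ p ^ 2) ^ (k - r) = q ^ (p ^ 2 * ((k : ℤ) - r)) := by
    rw [zpow_mul, ← Nat.cast_sub (by omega), zpow_natCast]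
  have e4 : (q ^ (p ^ 2 + p)) ^ (r + 1) = q ^ ((p ^ 2 + p) * (r + 1)) := by
    rw [zpow_mul]
    exact_mod_cast rfl
  have e5 : (q ^ p) ^ m = q ^ (p * m) := by rw [zpow_mul, zpow_natCast]
  have e6 : (q ^ (-p)) ^ (j - m) = q ^ (-p * ((j : ℤ) - m)) := by
    rw [zpow_mul, ← Nat.cast_sub hmj, zpow_natCast]
  have hexp : p ^ 2 * ((k : ℤ) - r) + (p * m) + (-p * ((j : ℤ) - m)) + (p ^ 2 + p) * (r + 1) +
      tri p = ((k : ℤ) + 2 + r - j + 2 * m) * p + (2 * k + 3 : ℕ) * tri p := by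
    have := two_mul_tri p
    push_cast
    linear_combination (-((k : ℤ) + 1)) * this
  have hq := congrArg (fun x : ℤ => q ^ x) hexp
  simp only [zpow_add₀ hq0 _ _] at hq
  rw [e1, e2, e3, e4, e5, e6]
  linear_combination ((-1) ^ p * (j.choose m : ℂ)) * hq

/-- Compares two limits of `β_L`: the chain side gives the wanted sum over `(q)_∞`, the `α` side
gives `∑ α_p` over `(q)_∞^2`. -/
theorem hasSum_binom_andrews_gordon {q : ℂ} (hq0 : q ≠ 0) (hq1 : ‖q‖ < 1) {k r j : ℕ}
    (hjr : j + r ≤ k) {S : Finset ℕ} (hS : S ⊆ Icc 1 (k - r)) (hj : S.card = j) :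
    HasSum (fun s : Chain k => (∏ i ∈ S, binomFactor q s i) * agTerm q k r s)
      (productSide q k r j) := by
  classical
  have hE := qPochInf_self_ne_zero hq1
  set χ : ℕ → Prop := fun i => i + 1 ∈ S with hχ
  set F : (Fin k → ℕ) → ℂ := fun s => if h : Antitone s then
    (∏ i ∈ S, binomFactor q (⟨s, h⟩ : Chain k) i) * agTerm q k r ⟨s, h⟩ else 0 with hF
  obtain ⟨bound, hbound, hle⟩ := exists_bound_chainTerm hq0 hq1 (k - r) χ k
  obtain ⟨β, hβ, hpair⟩ := exists_isBaileyPair_chain hq0 hq1 (k - r) r (by omega : k = _) χ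
  have hα := hasSum_alphaChain hq0 hq1 hjr hS hj
  have hlim : ∀ s, Tendsto (fun L => chainTerm q (weight q (k - r) χ) L s) atTop
      (𝓝 (F s * (qPochInf q q)⁻¹)) := by
    intro s
    by_cases h : Antitone s
    · have h1 := fun L => chainTerm_chain hq0 hS (⟨s, h⟩ : Chain k) L
      simp only [hF, dif_pos h]
      refine Tendsto.congr (fun L => (h1 L).symm) (tendsto_const_nhds.mul ?_)
      rw [← mul_one (qPochInf q q)⁻¹]
      simp only [sub_eq_add_neg]
      refine (tendsto_invPoch_natCast_add hq1 _).mul ?_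
      split_ifs
      · have h2 : Tendsto (fun L : ℕ => q ^ L) atTop (𝓝 0) :=
          tendsto_pow_atTop_nhds_zero_of_norm_lt_one hq1
        have h3 := (h2.comp (tendsto_add_atTop_nat (Chain.part (⟨s, h⟩ : Chain k) 1))).const_add 1
        rw [add_zero] at h3
        exact h3
      · exact tendsto_const_nhds
    · simp only [hF, dif_neg h, zero_mul, chainTerm_of_not_antitone q _ _ h]
      exact tendsto_const_nhds
  -- The `L`-uniform bound passes to the pointwise limit, which gives the absolute convergence.
  have hFs : Summable fun s => F s * (qPochInf q q)⁻¹ :=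
    hbound.of_norm_bounded fun s => le_of_tendsto (hlim s).norm (Eventually.of_forall (hle · s))
  have hleft := tendsto_tsum_of_dominated_convergence hbound hlim (Eventually.of_forall hle)
  have hright := tendsto_tsum_kernel hq1 hα.summable
  have heq : ∀ L : ℕ, ∑' s : Fin k → ℕ, chainTerm q (weight q (k - r) χ) L s =
      ∑' p : ℤ, alphaChain q (k - r) χ r p * kernel q 0 L p := by
    intro L
    rw [(hβ L).tsum_eq, ← (hpair L).tsum_eq, Nat.cast_zero]
  simp only [heq] at hleft
  have hval := tendsto_nhds_unique hleft hright
  rw [hα.tsum_eq] at hval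
  have hsum := hFs.hasSum.mul_right (qPochInf q q)
  rw [hval] at hsum
  have hsum' : HasSum F (productSide q k r j) := by
    have e : productSide q k r j * qPochInf q q * ((qPochInf q q)⁻¹ * (qPochInf q q)⁻¹) *
        qPochInf q q = productSide q k r j := by
      field_simp
    rw [e] at hsum
    exact hsum.congr_fun fun s => (inv_mul_cancel_right₀ hE (F s)).symm
  have hinj : Function.Injective (Subtype.val : Chain k → Fin k → ℕ) := Subtype.val_injective
  refine ((hinj.hasSum_iff fun s hs => ?_).2 hsum').congr_fun fun s => ?_
  · exact dif_neg fun h => hs ⟨⟨s, h⟩, rfl⟩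
  · simp only [hF, Function.comp, dif_pos s.2]

theorem zpow_mul_prod_eq_prod_binomFactor {q : ℂ} (hq0 : q ≠ 0) {k : ℕ} (s : Chain k) (j : ℕ) :
    q ^ (-∑ i ∈ Icc 1 j, (s.part i : ℤ)) *
      (∏ i ∈ Icc 2 j, (1 + q ^ (s.part (i - 1) + s.part i))) =
    ∏ i ∈ Icc 1 j, binomFactor q s i := by
  induction j with
  | zero => simp
  | succ j ih =>
    rw [prod_Icc_succ_top (a := 1) (by omega), ← ih, sum_Icc_succ_top (by omega), neg_add, zpow_add₀ hq0]
    cases j with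
    | zero => simp [binomFactor]
    | succ j =>
      rw [prod_Icc_succ_top (a := 2) (b := j + 1) (by omega)]
      simp only [binomFactor]
      rw [if_neg (by omega)]
      ring

end BinomialAndrewsGordon

end

theorem theorem3p1 (q : ℂ) (hq0 : q ≠ 0) (hq1 : ‖q‖ < 1) (k r j : ℕ) (hjr : j + r ≤ k) :
    HasSum
      (fun s : BinomialAndrewsGordon.Chain k =>
        q ^ (-∑ i ∈ Finset.Icc 1 j, (s.part i : ℤ)) *
          (∏ i ∈ Finset.Icc 2 j, (1 + q ^ (s.part (i - 1) + s.part i))) *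
          BinomialAndrewsGordon.agTerm q k r s)
      (BinomialAndrewsGordon.productSide q k r j) ∧
    ∀ S : Finset ℕ, S ⊆ Finset.Icc 1 (k - r) → S.card = j →
      HasSum
        (fun s : BinomialAndrewsGordon.Chain k =>
          (∏ i ∈ S, BinomialAndrewsGordon.binomFactor q s i) *
            BinomialAndrewsGordon.agTerm q k r s)
        (BinomialAndrewsGordon.productSide q k r j) := by
  refine ⟨?_, fun S hS hj => BinomialAndrewsGordon.hasSum_binom_andrews_gordon hq0 hq1 hjr hS hj⟩
  simp only [BinomialAndrewsGordon.zpow_mul_prod_eq_prod_binomFactor hq0]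
  -- The displayed identity is the case `S = {1, …, j}`, admissible because `j ≤ k - r`.
  exact BinomialAndrewsGordon.hasSum_binom_andrews_gordon hq0 hq1 hjr
    (Finset.Icc_subset_Icc_right (by omega)) (by simp)
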